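/- Let $\phi:\mathbb{R}^n\to\mathbb{R}$ be differentiable and strictly convex, let $\Delta_\phi$ be the set of $y\in\mathbb{R}^n$ such that $x\mapsto\phi(x)-x\cdot y$ is bounded from below, and let $\phi^*(y)=\sup_x\{x\cdot y-\phi(x)\}$ be the Legendre transform of $\phi$. Let $u$ be a bounded, strictly concave function on $\Delta_\phi$ that is smooth in the interior of $\Delta_\phi$. For $t\ge 0$ put $\tilde\phi_t:=(\phi^*-tu)^*$, where $\phi^*-tu$ is understood to be $+\infty$ outside $\Delta_\phi$, that is, $\tilde\phi_t(x)=\sup_{y\in\Delta_\phi}\{x\cdot y-\phi^*(y)+tu(y)\}$. For $\lambda\in\mathbb{R}$ let $A_\lambda:=\{y\in\Delta_\phi: u(y)\ge\lambda\}$ and $$\phi_\lambda:=\sup\{\psi\le\phi:\ \psi\in\operatorname{Conv}(\mathbb{R}^n),\ \Delta_\psi\subseteq A_\lambda\},$$ where $\operatorname{Conv}(\mathbb{R}^n)$ consists of the finite convex functions on $\mathbb{R}^n$ and the function identically $-\infty$, and $\Delta_\psi$ is defined like $\Delta_\phi$; put $\widehat\phi_t:=\sup_{\lambda\in\mathbb{R}}\{\phi_\lambda+t\lambda\}$.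 Then $\tilde\phi_t=\widehat\phi_t$ for all $t\ge 0$. Moreover the curve $\tilde\phi_t$, $t\in[0,\infty)$, solves the Cauchy problem for the homogeneous real Monge-Ampère equation with initial data $(\phi,\,u\circ\nabla\phi)$: the function $u\circ\nabla\phi$ is bounded and continuous on $\mathbb{R}^n$, the function $\tilde\Phi(x,t):=\tilde\phi_t(x)$ is finite and convex on $\mathbb{R}^n\times[0,\infty)$, its (Alexandrov) Monge-Ampère measure vanishes on $\mathbb{R}^n\times(0,\infty)$, $\tilde\phi_0=\phi$, and $\frac{\partial}{\partial t}\big|_{t=0^+}\tilde\phi_t=u\circ\nabla\phi$. -/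

import Mathlib

open Set

noncomputable section

namespace HRMA

/-- `ℝⁿ` with its Euclidean structure. -/
abbrev Sp (n : ℕ) : Type := EuclideanSpace ℝ (Fin n)

/-- Space-time `ℝⁿ × ℝ` with its Euclidean structure (and its Lebesgue measure `volume`). -/
abbrev SpTime (n : ℕ) : Type := WithLp 2 (Sp n × ℝ)

/-- The point `(x, t)` of space-time. -/
def pt {n : ℕ} (x : Sp n) (t : ℝ) : SpTime n := WithLp.toLp 2 (x, t)

/-- A real-valued function seen as an extended-real-valued one. -/
def asEReal {n : ℕ} (φ : Sp n → ℝ) : Sp n → EReal := fun x => (φ x : EReal)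

/-- `Conv(ℝⁿ)`: the (finite-valued) convex functions on `ℝⁿ`, together with the function
identically equal to `-∞`. -/
def Conv (n : ℕ) : Set (Sp n → EReal) :=
  {ψ | (∃ f : Sp n → ℝ, ConvexOn ℝ univ f ∧ ψ = asEReal f) ∨ ψ = fun _ => ⊥}

/-- `Δ_ψ`: the set of `y` such that `ψ(x) - x · y` is bounded from below. -/
def Delta {n : ℕ} (ψ : Sp n → EReal) : Set (Sp n) :=
  {y | ∃ c : ℝ, ∀ x : Sp n, ((inner ℝ x y + c : ℝ) : EReal) ≤ ψ x}

/-- The Legendre transform `f^*(y) = sup_x {x · y - f(x)}`. -/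
def legendre {n : ℕ} (f : Sp n → EReal) : Sp n → EReal :=
  fun y => ⨆ x : Sp n, ((inner ℝ x y : ℝ) : EReal) - f x

open Classical in
/-- The function `φ^* - t u` on `Δ_φ`, extended by `+∞` outside of `Δ_φ`. -/
def dualMinus {n : ℕ} (φ u : Sp n → ℝ) (t : ℝ) : Sp n → EReal :=
  fun y => if y ∈ Delta (asEReal φ) then legendre (asEReal φ) y - ((t * u y : ℝ) : EReal) else ⊤

/-- The curve `t ↦ (φ^* - t u)^*`. -/
def tildeCurve {n : ℕ} (φ u : Sp n → ℝ) (t : ℝ) : Sp n → EReal :=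
  legendre (dualMinus φ u t)

/-- `A_λ`: the subset of `Δ_φ` where `u ≥ λ`. -/
def superlevel {n : ℕ} (φ u : Sp n → ℝ) (l : ℝ) : Set (Sp n) :=
  {y | y ∈ Delta (asEReal φ) ∧ l ≤ u y}

/-- The envelope `φ_λ = sup {ψ ≤ φ : ψ ∈ Conv(ℝⁿ), Δ_ψ ⊆ A_λ}` (pointwise supremum). -/
def envelope {n : ℕ} (φ u : Sp n → ℝ) (l : ℝ) : Sp n → EReal :=
  sSup {ψ | ψ ∈ Conv n ∧ ψ ≤ asEReal φ ∧ Delta ψ ⊆ superlevel φ u l}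

/-- The Legendre transform in the parameter, `t ↦ sup_λ {φ_λ + t λ}`. -/
def hatCurve {n : ℕ} (φ u : Sp n → ℝ) (t : ℝ) : Sp n → EReal :=
  fun x => ⨆ l : ℝ, envelope φ u l x + ((t * l : ℝ) : EReal)

/-- The subdifferential at `p` of a function `F` on `Ω`: the `q` such that
`F(p') ≥ F(p) + q · (p' - p)` for all `p' ∈ Ω`. -/
def subdiff {V : Type*} [NormedAddCommGroup V] [InnerProductSpace ℝ V]
    (Ω : Set V) (F : V → ℝ) (p : V) : Set V :=
  {q | ∀ p' ∈ Ω, F p + inner ℝ q (p' - p) ≤ F p'}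

/-- `μ` is the real Monge-Ampère measure `MA(F)` on `Ω` of the convex function `F`, in the sense
of Alexandrov: the mass of a Borel set `B ⊆ Ω` is the Lebesgue measure of its image under the
(multivalued) gradient map of `F`. For `F` of class `C²` this is `det(∇²F) dx`, and it is the
continuous extension of that operator to all finite convex functions on the convex open set
`Ω`. -/
def IsMongeAmpereMeasure {V : Type*} [NormedAddCommGroup V] [InnerProductSpace ℝ V]
    [FiniteDimensional ℝ V] [MeasurableSpace V] [BorelSpace V]
    (Ω : Set V) (F : V → ℝ) (μ : MeasureTheory.Measure V) : Prop :=
  ∀ B ⊆ Ω, MeasurableSet B → μ B = MeasureTheory.volume (⋃ p ∈ B, subdiff Ω F p)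

/-- The curve `c_t`, `t ∈ [0, ∞)`, of functions on `ℝⁿ` solves the Cauchy problem for the
homogeneous real Monge-Ampère equation with initial data `(φ, v)`. -/
structure SolvesHRMA {n : ℕ} (φ v : Sp n → ℝ) (c : ℝ → Sp n → EReal) : Prop where
  /-- the initial velocity is continuous -/
  continuous_velocity : Continuous v
  /-- the initial velocity is bounded -/
  bounded_velocity : ∃ M : ℝ, ∀ x, |v x| ≤ M
  /-- the curve is finite-valued, convex on `ℝⁿ × [0, ∞)`, has vanishing Monge-Ampère measure
  on `ℝⁿ × (0, ∞)`, and has the initial value `φ` and the initial velocity `v` -/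
  equation : ∃ Φ : SpTime n → ℝ,
    (∀ t : ℝ, 0 ≤ t → ∀ x : Sp n, c t x = (Φ (pt x t) : EReal)) ∧
    ConvexOn ℝ {p : SpTime n | 0 ≤ p.snd} Φ ∧
    IsMongeAmpereMeasure {p : SpTime n | 0 < p.snd} Φ 0 ∧
    (∀ x : Sp n, Φ (pt x 0) = φ x) ∧
    (∀ x : Sp n, HasDerivWithinAt (fun t : ℝ => Φ (pt x t)) (v x) (Ici 0) 0)

end HRMA

end

/-! Everything is read off from a supremum of affine functions: `tildeCurve` at `(x, t)` is the
supremum over `y ∈ Δ_φ` of `y · x - φ^*(y) + t u(y)` (`tildeCurve_eq_iSup`). The envelope `φ_λ` is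
the supremum of `y · x - φ^*(y)` over `u(y) ≥ λ` (`envelope_eq_iSup`), so the two curves agree by
exchanging suprema.

Since `u` is bounded, the supremum is finite and jointly convex in `(x, t)`. At `t > 0` its
subgradients project into `Δ_φ`, and those over the interior lie on the graph of `u`
(`snd_eq_of_mem_subdiff`). The graph and the part over the frontier of the convex set `Δ_φ` are
null, so the Monge-Ampère measure vanishes.

At `t = 0` the supremum is attained at `∇φ(x)`, an interior point of `Δ_φ` by strict convexity.
Indices away from it lose a fixed amount, so for small `t` only values of `u` near `∇φ(x)` matter,
which gives the initial velocity. -/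

/-! ### Subgradients and gradients of convex functions -/

section ConvexAnalysis

open Metric

variable {E : Type*} [NormedAddCommGroup E] [InnerProductSpace ℝ E] [FiniteDimensional ℝ E]

/-- A convex function has a subgradient at every interior point of its domain. -/
theorem ConvexOn.exists_subgradient {s : Set E} {f : E → ℝ} (hf : ConvexOn ℝ s f) {q : E}
    (hq : q ∈ interior s) : ∃ g : E, ∀ y ∈ s, f q + inner ℝ g (y - q) ≤ f y := by
  have hfi : ConvexOn ℝ (interior s) f := hf.subset interior_subset hf.1.interior
  have hcont : ContinuousOn f (interior s) := hfi.continuousOn isOpen_interior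
  have hopen : IsOpen {p : E × ℝ | p.1 ∈ interior s ∧ f p.1 < p.2} := by
    have h1 : IsOpen (Prod.fst ⁻¹' interior s : Set (E × ℝ)) :=
      isOpen_interior.preimage continuous_fst
    have h2 : ContinuousOn (fun p : E × ℝ => p.2 - f p.1) (Prod.fst ⁻¹' interior s) :=
      continuousOn_snd.sub (hcont.comp continuousOn_fst fun p hp => hp)
    convert h2.isOpen_inter_preimage h1 (isOpen_Ioi (a := (0 : ℝ))) using 1
    ext p
    simp
  obtain ⟨l, hl⟩ := geometric_hahn_banach_open_point (x := (q, f q))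
    hfi.convex_strict_epigraph hopen (by simp)
  have hsplit : ∀ (p : E) (r : ℝ), l (p, r) = l (p, 0) + r * l (0, 1) := fun p r => by
    have : ((p, r) : E × ℝ) = (p, 0) + r • (0, 1) := by simp
    rw [this, map_add, map_smul, smul_eq_mul]
  set c := l (0, 1) with hc
  -- The separating functional is smaller on the epigraph, which extends upwards, so it cannot be
  -- vertical.
  have hcneg : c < 0 := by
    have := hl (q, f q + 1) ⟨hq, by simp⟩
    rw [hsplit q (f q + 1), hsplit q (f q)] at this
    linarith
  have hle : ∀ y ∈ interior s, l (y, 0) + f y * c ≤ l (q, 0) + f q * c := by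
    intro y hy
    refine le_of_forall_pos_le_add fun ε hε => ?_
    have := hl (y, f y + ε / (-c)) ⟨hy, by simpa using div_pos hε (neg_pos.2 hcneg)⟩
    rw [hsplit y, hsplit q (f q), add_mul] at this
    have h3 : ε / (-c) * c = -ε := by field_simp [hcneg.ne]
    linarith
  set m : StrongDual ℝ E := (-c)⁻¹ • l.comp (ContinuousLinearMap.inl ℝ E ℝ) with hm
  have hmle : ∀ y ∈ interior s, f q + m (y - q) ≤ f y := by
    intro y hy
    have h1 : m (y - q) = (-c)⁻¹ * (l (y, 0) - l (q, 0)) := by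
      rw [map_sub, mul_sub]; simp [hm]
    have h2 : (-c)⁻¹ * (l (y, 0) - l (q, 0)) ≤ f y - f q := by
      rw [inv_mul_le_iff₀ (neg_pos.2 hcneg)]
      linarith [hle y hy]
    linarith
  refine ⟨(InnerProductSpace.toDual ℝ E).symm m, fun y hy => ?_⟩
  rw [InnerProductSpace.toDual_symm_apply]
  -- The midpoint of `q` and any `y ∈ s` is interior; convexity carries the bound from there to `y`.
  have hmid := hf.1.combo_interior_self_mem_interior hq hy (a := 1 / 2) (b := 1 / 2)
    (by norm_num) (by norm_num) (by norm_num)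
  have h1 := hmle _ hmid
  have h2 := hf.2 (interior_subset hq) hy (by norm_num : (0 : ℝ) ≤ 1 / 2)
    (by norm_num : (0 : ℝ) ≤ 1 / 2) (by norm_num)
  have h3 : (1 / 2 : ℝ) • q + (1 / 2 : ℝ) • y - q = (1 / 2 : ℝ) • (y - q) := by module
  rw [h3, map_smul] at h1
  simp only [smul_eq_mul] at h1 h2
  linarith

variable {f : E → ℝ}

/-- The graph of a convex function lies above its tangent hyperplanes. -/
theorem ConvexOn.add_inner_gradient_le (hf : ConvexOn ℝ univ f) (hd : Differentiable ℝ f)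
    (x h : E) : f x + inner ℝ (gradient f x) h ≤ f (x + h) := by
  obtain ⟨g, hg⟩ := hf.exists_subgradient (q := x) (by simp)
  have hmin : IsLocalMin (fun y => f y - inner ℝ g y) x := by
    refine Filter.Eventually.of_forall fun y => ?_
    have := hg y (mem_univ y)
    rw [inner_sub_right] at this
    simp only
    linarith
  have hder := hmin.hasFDerivAt_eq_zero
    ((hd x).hasFDerivAt.sub (innerSL ℝ g).hasFDerivAt)
  have hgh : inner ℝ (gradient f x) h = inner ℝ g h := by
    have := DFunLike.congr_fun hder h
    simp only [sub_apply, innerSL_apply_apply,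
      zero_apply] at this
    rw [inner_gradient_left]
    linarith
  have := hg (x + h) (mem_univ _)
  rw [hgh]
  simpa using this

/-- First order expansion from above on a small ball. -/
theorem exists_le_add_inner_gradient (hd : Differentiable ℝ f) (x : E) {ε : ℝ}
    (hε : 0 < ε) : ∃ δ > 0, ∀ h : E, ‖h‖ ≤ δ →
      f (x + h) ≤ f x + inner ℝ (gradient f x) h + ε * ‖h‖ := by
  have h1 := hasGradientAt_iff_isLittleO_nhds_zero.1 (hd x).hasGradientAt
  obtain ⟨δ, hδ, H⟩ := Metric.nhds_basis_closedBall.eventually_iff.1 (h1.def hε)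
  refine ⟨δ, hδ, fun h hh => ?_⟩
  have := H (mem_closedBall_zero_iff.2 hh)
  rw [Real.norm_eq_abs] at this
  linarith [(abs_le.1 this).2]

/-- The gradient of a differentiable convex function is continuous. -/
theorem ConvexOn.continuous_gradient (hf : ConvexOn ℝ univ f) (hd : Differentiable ℝ f) :
    Continuous (gradient f) := by
  refine continuous_iff_continuousAt.2 fun x₀ => ?_
  rw [ContinuousAt, Metric.tendsto_nhds]
  intro ε hε
  set y₀ := gradient f x₀ with hy₀
  obtain ⟨δ, hδ, H⟩ := exists_le_add_inner_gradient hd x₀ (ε := ε / 4) (by positivity)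
  have hlim : Filter.Tendsto (fun x => f x₀ - f x + ‖y₀‖ * ‖x - x₀‖) (nhds x₀) (nhds 0) := by
    have hc : Continuous fun x => f x₀ - f x + ‖y₀‖ * ‖x - x₀‖ := by
      have := hd.continuous
      fun_prop
    simpa using hc.tendsto x₀
  filter_upwards [hlim.eventually (gt_mem_nhds (show 0 < δ * ε / 8 by positivity)),
    Metric.ball_mem_nhds x₀ (show 0 < δ / 2 by positivity)] with x hx hxb
  rw [mem_ball, dist_eq_norm] at hxb
  rw [dist_eq_norm]
  set y := gradient f x with hy
  by_contra! hcon
  have hpos : 0 < ‖y - y₀‖ := hε.trans_le hcon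
  -- Moving by `δ` along `y - y₀` separates the tangent at `x` from the upper bound at `x₀` as much
  -- as possible.
  set h := (δ / ‖y - y₀‖) • (y - y₀) with hh
  have hnorm : ‖h‖ = δ := by
    rw [hh, norm_smul, Real.norm_of_nonneg (by positivity)]
    field_simp
  have hinner : inner ℝ (y - y₀) h = δ * ‖y - y₀‖ := by
    rw [hh, inner_smul_right, real_inner_self_eq_norm_sq]
    field_simp
  have h1 := H h hnorm.le
  have h2 := hf.add_inner_gradient_le hd x (x₀ + h - x)
  rw [add_sub_cancel, ← hy, show x₀ + h - x = h - (x - x₀) by abel, inner_sub_right] at h2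
  rw [inner_sub_left] at hinner
  have h3 : inner ℝ y (x - x₀) ≤ (‖y - y₀‖ + ‖y₀‖) * ‖x - x₀‖ :=
    (real_inner_le_norm _ _).trans (by
      gcongr
      simpa using norm_add_le (y - y₀) y₀)
  rw [hnorm, ← hy₀] at h1
  have h4 : ‖y - y₀‖ * ‖x - x₀‖ ≤ ‖y - y₀‖ * (δ / 2) := by gcongr
  have h5 : δ * ε ≤ δ * ‖y - y₀‖ := by gcongr
  nlinarith

/-- A strictly convex function grows linearly after subtraction of a tangent. -/
theorem StrictConvexOn.exists_linear_growth (hf : StrictConvexOn ℝ univ f)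
    (hd : Differentiable ℝ f) (x : E) :
    ∃ m > 0, ∀ h : E, f x + inner ℝ (gradient f x) h + m * ‖h‖ - m ≤ f (x + h) := by
  set g : E → ℝ := fun h => f (x + h) - f x - inner ℝ (gradient f x) h with hg
  have hg0 : ∀ h, 0 ≤ g h := fun h => by
    have := hf.convexOn.add_inner_gradient_le hd x h
    simp only [hg]; linarith
  have hgpos : ∀ h, h ≠ 0 → 0 < g h := fun h hh => by
    have h1 := hf.2 (mem_univ x) (mem_univ (x + h)) (by simpa using hh)
      (by norm_num : (0 : ℝ) < 1 / 2) (by norm_num : (0 : ℝ) < 1 / 2) (by norm_num)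
    have h2 := hf.convexOn.add_inner_gradient_le hd x ((1 / 2 : ℝ) • h)
    rw [show (1 / 2 : ℝ) • x + (1 / 2 : ℝ) • (x + h) = x + (1 / 2 : ℝ) • h by module] at h1
    rw [inner_smul_right] at h2
    simp only [smul_eq_mul] at h1
    simp only [hg]; linarith
  have hgc : Continuous g := by
    have := hd.continuous
    fun_prop
  obtain ⟨m, hm, hms⟩ : ∃ m > 0, ∀ h ∈ sphere (0 : E) 1, m ≤ g h := by
    rcases (sphere (0 : E) 1).eq_empty_or_nonempty with he | hne
    -- The sphere is empty when `E` is trivial; any `m` then works.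
    · exact ⟨1, one_pos, by simp [he]⟩
    · obtain ⟨z, hz, hmin⟩ := (isCompact_sphere (0 : E) 1).exists_isMinOn hne hgc.continuousOn
      refine ⟨g z, hgpos z ?_, fun h hh => hmin hh⟩
      rintro rfl
      simp at hz
  refine ⟨m, hm, fun h => ?_⟩
  suffices m * ‖h‖ - m ≤ g h by simp only [hg] at this; linarith
  -- Inside the unit ball the left side is nonpositive; outside, convexity and `g 0 = 0` propagate
  -- the bound from the sphere along rays.
  rcases le_or_gt ‖h‖ 1 with hle | hgt
  · nlinarith [hg0 h]
  · have hpos : 0 < ‖h‖ := one_pos.trans hgt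
    have h1 := hms (‖h‖⁻¹ • h) (by simp [norm_smul, hpos.ne'])
    have hinv : ‖h‖⁻¹ ≤ 1 := inv_le_one_of_one_le₀ hgt.le
    have h2 := hf.convexOn.2 (mem_univ x) (mem_univ (x + h))
      (by linarith : 0 ≤ 1 - ‖h‖⁻¹) (by positivity : 0 ≤ ‖h‖⁻¹) (by ring)
    rw [show (1 - ‖h‖⁻¹) • x + ‖h‖⁻¹ • (x + h) = x + ‖h‖⁻¹ • h by module] at h2
    have h3 : g (‖h‖⁻¹ • h) ≤ ‖h‖⁻¹ * g h := by
      simp only [hg, inner_smul_right, smul_eq_mul] at h2 ⊢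
      linarith
    have h4 : m * ‖h‖ ≤ g h := by
      have := h1.trans h3
      rw [inv_mul_eq_div, le_div_iff₀ hpos] at this
      exact this
    linarith

end ConvexAnalysis
-- Dual formulas for the two curves
noncomputable section ConjugateFunction

namespace HRMA

variable {n : ℕ} {φ u : Sp n → ℝ} {x y : Sp n} {t M : ℝ}

/-- The Legendre transform of a real-valued function, as a real-valued function. -/
def realConj (φ : Sp n → ℝ) (y : Sp n) : ℝ := ⨆ x : Sp n, (inner ℝ x y - φ x)

theorem mem_Delta_asEReal :
    y ∈ Delta (asEReal φ) ↔ ∃ c : ℝ, ∀ x : Sp n, inner ℝ x y + c ≤ φ x := by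
  simp only [Delta, asEReal, mem_ofPred_eq, EReal.coe_le_coe_iff]

/-- Needed because off `Δ_φ` the real supremum `realConj` takes the default value `0`. -/
theorem bddAbove_of_mem_Delta (hy : y ∈ Delta (asEReal φ)) :
    BddAbove (range fun x : Sp n => inner ℝ x y - φ x) := by
  obtain ⟨c, hc⟩ := mem_Delta_asEReal.1 hy
  refine ⟨-c, ?_⟩
  rintro _ ⟨x, rfl⟩
  simp only
  linarith [hc x]

theorem inner_sub_le_realConj (hy : y ∈ Delta (asEReal φ)) (x : Sp n) :
    inner ℝ x y - φ x ≤ realConj φ y :=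
  le_ciSup (bddAbove_of_mem_Delta hy) x

theorem realConj_le {c : ℝ} (h : ∀ x, inner ℝ x y - φ x ≤ c) : realConj φ y ≤ c :=
  ciSup_le h

theorem coe_ciSup_ereal {ι : Type*} [Nonempty ι] {f : ι → ℝ} (hf : BddAbove (range f)) :
    ((⨆ i, f i : ℝ) : EReal) = ⨆ i, (f i : EReal) :=
  EReal.coe_strictMono.monotone.map_ciSup_of_continuousAt
    continuous_coe_real_ereal.continuousAt hf

theorem legendre_asEReal (hy : y ∈ Delta (asEReal φ)) :
    legendre (asEReal φ) y = (realConj φ y : EReal) := by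
  rw [realConj, coe_ciSup_ereal (bddAbove_of_mem_Delta hy)]
  simp only [legendre, asEReal, EReal.coe_sub]

theorem convexOn_realConj (φ : Sp n → ℝ) : ConvexOn ℝ (Delta (asEReal φ)) (realConj φ) := by
  have key : ∀ y ∈ Delta (asEReal φ), ∀ z ∈ Delta (asEReal φ), ∀ a b : ℝ, 0 ≤ a → 0 ≤ b →
      a + b = 1 → ∀ x, inner ℝ x (a • y + b • z) - φ x ≤
        a * realConj φ y + b * realConj φ z := by
    intro y hy z hz a b ha hb hab x
    have h1 := mul_le_mul_of_nonneg_left (inner_sub_le_realConj hy x) ha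
    have h2 := mul_le_mul_of_nonneg_left (inner_sub_le_realConj hz x) hb
    rw [inner_add_right, inner_smul_right, inner_smul_right]
    have h3 : φ x = a * φ x + b * φ x := by rw [← add_mul, hab, one_mul]
    linarith
  refine ⟨fun y hy z hz a b ha hb hab => mem_Delta_asEReal.2
    ⟨-(a * realConj φ y + b * realConj φ z), fun x => ?_⟩,
    fun y hy z hz a b ha hb hab => realConj_le fun x => key y hy z hz a b ha hb hab x⟩
  linarith [key y hy z hz a b ha hb hab x]

theorem convex_Delta (φ : Sp n → ℝ) : Convex ℝ (Delta (asEReal φ)) :=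
  (convexOn_realConj φ).1

theorem tildeCurve_eq_iSup (φ u : Sp n → ℝ) (t : ℝ) (x : Sp n) :
    tildeCurve φ u t x = ⨆ y : Delta (asEReal φ),
      ((inner ℝ (y : Sp n) x - realConj φ y + t * u y : ℝ) : EReal) := by
  have hval : ∀ y ∈ Delta (asEReal φ), ((inner ℝ y x : ℝ) : EReal) - dualMinus φ u t y =
      ((inner ℝ y x - realConj φ y + t * u y : ℝ) : EReal) := by
    intro y hy
    rw [dualMinus, if_pos hy, legendre_asEReal hy, ← EReal.coe_sub, ← EReal.coe_sub]
    congr 1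
    ring
  refine le_antisymm (iSup_le fun y => ?_) (iSup_le fun y => ?_)
  · by_cases hy : y ∈ Delta (asEReal φ)
    · rw [hval y hy]
      exact le_iSup (fun y : Delta (asEReal φ) =>
        ((inner ℝ (y : Sp n) x - realConj φ y + t * u y : ℝ) : EReal)) ⟨y, hy⟩
    · simp [dualMinus, hy]
  · rw [← hval y y.2]
    exact le_iSup (fun y : Sp n => ((inner ℝ y x : ℝ) : EReal) - dualMinus φ u t y) y

theorem convexOn_affine (y : Sp n) (c : ℝ) :
    ConvexOn ℝ univ fun x : Sp n => inner ℝ y x - c :=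
  ((innerSL ℝ y).toLinearMap.convexOn convex_univ).sub (concaveOn_const c convex_univ)

theorem Delta_affine_subset (y : Sp n) (c : ℝ) :
    Delta (asEReal fun x : Sp n => inner ℝ y x - c) ⊆ {y} := by
  intro z hz
  obtain ⟨b, hb⟩ := mem_Delta_asEReal.1 hz
  by_contra hne
  have hpos : 0 < ‖z - y‖ ^ 2 := by
    have : 0 < ‖z - y‖ := norm_pos_iff.2 (sub_ne_zero.2 hne)
    positivity
  obtain ⟨k, hk⟩ := exists_nat_gt ((-c - b) / ‖z - y‖ ^ 2)
  rw [div_lt_iff₀ hpos] at hk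
  have h1 := hb ((k : ℝ) • (z - y))
  have h2 : inner ℝ ((k : ℝ) • (z - y)) z - inner ℝ y ((k : ℝ) • (z - y)) =
      k * ‖z - y‖ ^ 2 := by
    rw [real_inner_comm _ y, ← inner_sub_right, real_inner_smul_left, real_inner_self_eq_norm_sq]
  linarith

/-- A subgradient `g` at `x` of a finite competitor `ψ` lies in `Δ_ψ ⊆ A_λ`, and `ψ ≤ φ` gives
`φ^*(g) ≤ g · x - ψ(x)`. Conversely, the affine minorant of `φ` with slope `y ∈ A_λ` is itself a
competitor. -/
theorem envelope_eq_iSup (φ u : Sp n → ℝ) (l : ℝ) (x : Sp n) :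
    envelope φ u l x = ⨆ y : superlevel φ u l,
      ((inner ℝ (y : Sp n) x - realConj φ y : ℝ) : EReal) := by
  rw [envelope, sSup_apply]
  refine le_antisymm (iSup_le ?_) (iSup_le fun y => ?_)
  · rintro ⟨ψ, ⟨f, hf, rfl⟩ | rfl, hle, hsub⟩
    · obtain ⟨g, hg⟩ := hf.exists_subgradient (q := x) (by simp)
      have hgs : g ∈ superlevel φ u l := hsub <| mem_Delta_asEReal.2
        ⟨f x - inner ℝ g x, fun z => by
          have := hg z (mem_univ z)
          rw [inner_sub_right] at this
          rw [real_inner_comm]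
          linarith⟩
      refine le_trans ?_ (le_iSup (fun y : superlevel φ u l =>
        ((inner ℝ (y : Sp n) x - realConj φ y : ℝ) : EReal)) ⟨g, hgs⟩)
      simp only [asEReal, EReal.coe_le_coe_iff]
      have : realConj φ g ≤ inner ℝ g x - f x := realConj_le fun z => by
        have h1 := hg z (mem_univ z)
        have h2 : f z ≤ φ z := EReal.coe_le_coe_iff.1 (hle z)
        rw [inner_sub_right] at h1
        rw [real_inner_comm]
        linarith
      linarith
    · exact bot_le
  · refine le_iSup (fun ψ : {ψ | ψ ∈ Conv n ∧ ψ ≤ asEReal φ ∧ Delta ψ ⊆ superlevel φ u l} =>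
      (ψ : Sp n → EReal) x) ⟨asEReal fun x => inner ℝ (y : Sp n) x - realConj φ y,
        Or.inl ⟨_, convexOn_affine _ _, rfl⟩, fun z => ?_,
        (Delta_affine_subset _ _).trans (singleton_subset_iff.2 y.2)⟩
    simp only [asEReal, EReal.coe_le_coe_iff]
    have := inner_sub_le_realConj y.2.1 z
    rw [real_inner_comm] at this
    linarith

theorem tildeCurve_eq_hatCurve (φ u : Sp n → ℝ) (ht : 0 ≤ t) :
    tildeCurve φ u t = hatCurve φ u t := by
  funext x
  rw [tildeCurve_eq_iSup, hatCurve]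
  refine le_antisymm (iSup_le fun y => ?_) (iSup_le fun l => ?_)
  -- The best level for the index `y` is `λ = u(y)`.
  · refine le_trans ?_ (le_iSup _ (u y))
    rw [EReal.coe_add, envelope_eq_iSup]
    gcongr
    exact le_iSup (fun z : superlevel φ u (u y) =>
      ((inner ℝ (z : Sp n) x - realConj φ z : ℝ) : EReal)) ⟨y, y.2, le_rfl⟩
  · rw [← EReal.le_sub_iff_add_le (Or.inl (EReal.coe_ne_bot _)) (Or.inl (EReal.coe_ne_top _)),
      envelope_eq_iSup]
    refine iSup_le fun y => ?_
    rw [EReal.le_sub_iff_add_le (Or.inl (EReal.coe_ne_bot _)) (Or.inl (EReal.coe_ne_top _))]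
    refine le_trans ?_ (le_iSup _ ⟨y, y.2.1⟩)
    rw [← EReal.coe_add, EReal.coe_le_coe_iff]
    gcongr
    exact y.2.2

/-- The real-valued function on space-time whose time slices are the curve `tildeCurve`. -/
def potential (φ u : Sp n → ℝ) (p : SpTime n) : ℝ :=
  ⨆ y : Delta (asEReal φ), (inner ℝ (y : Sp n) p.fst - realConj φ y + p.snd * u y)

theorem affine_le_add (hM : ∀ y ∈ Delta (asEReal φ), |u y| ≤ M) (hy : y ∈ Delta (asEReal φ))
    (x : Sp n) (t : ℝ) : inner ℝ y x - realConj φ y + t * u y ≤ φ x + |t| * M := by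
  have h1 := inner_sub_le_realConj hy x
  have h2 : t * u y ≤ |t| * M := (le_abs_self _).trans (by
    rw [abs_mul]
    exact mul_le_mul_of_nonneg_left (hM y hy) (abs_nonneg t))
  rw [real_inner_comm] at h1
  linarith

theorem le_potential (hM : ∀ y ∈ Delta (asEReal φ), |u y| ≤ M) (hy : y ∈ Delta (asEReal φ))
    (p : SpTime n) : inner ℝ y p.fst - realConj φ y + p.snd * u y ≤ potential φ u p := by
  refine le_ciSup (f := fun y : Delta (asEReal φ) =>
    inner ℝ (y : Sp n) p.fst - realConj φ y + p.snd * u y) ⟨φ p.fst + |p.snd| * M, ?_⟩ ⟨y, hy⟩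
  rintro _ ⟨z, rfl⟩
  exact affine_le_add hM z.2 _ _

theorem potential_le (hne : (Delta (asEReal φ)).Nonempty) {p : SpTime n} {c : ℝ}
    (h : ∀ y ∈ Delta (asEReal φ), inner ℝ y p.fst - realConj φ y + p.snd * u y ≤ c) :
    potential φ u p ≤ c :=
  have := hne.to_subtype
  ciSup_le fun y => h y y.2

theorem tildeCurve_eq_potential (hM : ∀ y ∈ Delta (asEReal φ), |u y| ≤ M)
    (hne : (Delta (asEReal φ)).Nonempty) (t : ℝ) (x : Sp n) :
    tildeCurve φ u t x = (potential φ u (pt x t) : EReal) := by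
  have := hne.to_subtype
  rw [tildeCurve_eq_iSup, potential, coe_ciSup_ereal]
  · rfl
  · refine ⟨φ x + |t| * M, ?_⟩
    rintro _ ⟨z, rfl⟩
    exact affine_le_add hM z.2 _ _

theorem convexOn_potential (hM : ∀ y ∈ Delta (asEReal φ), |u y| ≤ M)
    (hne : (Delta (asEReal φ)).Nonempty) : ConvexOn ℝ univ (potential φ u) := by
  refine ⟨convex_univ, fun p _ q _ a b ha hb hab => potential_le hne fun y hy => ?_⟩
  have h1 := mul_le_mul_of_nonneg_left (le_potential hM hy p) ha
  have h2 := mul_le_mul_of_nonneg_left (le_potential hM hy q) hb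
  have h3 : realConj φ y = a * realConj φ y + b * realConj φ y := by
    rw [← add_mul, hab, one_mul]
  simp only [WithLp.add_fst, WithLp.smul_fst, WithLp.add_snd, WithLp.smul_snd, inner_add_right,
    inner_smul_right, smul_eq_mul]
  linarith

end HRMA

end ConjugateFunction
-- Initial data and Monge-Ampère measure
noncomputable section CauchyProblem

namespace HRMA

open MeasureTheory Filter Topology

variable {n : ℕ} {φ u : Sp n → ℝ} {x y : Sp n} {t M : ℝ}

/-- Growth at rate `m` above the tangent leaves room to tilt the slope by less than `m`. -/
theorem gradient_mem_interior_Delta (hc : StrictConvexOn ℝ univ φ) (hd : Differentiable ℝ φ)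
    (x : Sp n) : gradient φ x ∈ interior (Delta (asEReal φ)) := by
  obtain ⟨m, hm, hg⟩ := hc.exists_linear_growth hd x
  refine mem_interior_iff_mem_nhds.2 (Filter.mem_of_superset (Metric.ball_mem_nhds _ hm) ?_)
  intro y hy
  rw [mem_ball_iff_norm] at hy
  refine mem_Delta_asEReal.2 ⟨φ x - m - inner ℝ x y, fun z => ?_⟩
  have h1 := hg (z - x)
  rw [add_sub_cancel] at h1
  have h2 : inner ℝ (y - gradient φ x) (z - x) ≤ m * ‖z - x‖ :=
    (real_inner_le_norm _ _).trans (by gcongr)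
  rw [inner_sub_left, inner_sub_right y, real_inner_comm z, real_inner_comm x] at h2
  linarith

theorem realConj_gradient (hc : ConvexOn ℝ univ φ) (hd : Differentiable ℝ φ) (x : Sp n) :
    realConj φ (gradient φ x) ≤ inner ℝ (gradient φ x) x - φ x := by
  refine realConj_le fun z => ?_
  have := hc.add_inner_gradient_le hd x (z - x)
  rw [add_sub_cancel, inner_sub_right] at this
  rw [real_inner_comm]
  linarith

theorem potential_zero (hM : ∀ y ∈ Delta (asEReal φ), |u y| ≤ M)
    (hc : StrictConvexOn ℝ univ φ) (hd : Differentiable ℝ φ) (x : Sp n) :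
    potential φ u (pt x 0) = φ x := by
  have hmem := interior_subset (gradient_mem_interior_Delta hc hd x)
  refine le_antisymm (potential_le ⟨_, hmem⟩ fun y hy => ?_) ?_
  · simpa [pt] using affine_le_add hM hy x 0
  · have h1 := le_potential hM hmem (pt x 0)
    have h2 := realConj_gradient hc.convexOn hd x
    simp only [pt, WithLp.toLp_fst, WithLp.toLp_snd, zero_mul, add_zero] at h1
    simp only [pt]
    linarith

theorem hasDerivWithinAt_potential (hM : ∀ y ∈ Delta (asEReal φ), |u y| ≤ M)
    (hu : ContinuousOn u (interior (Delta (asEReal φ))))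
    (hc : StrictConvexOn ℝ univ φ) (hd : Differentiable ℝ φ) (x : Sp n) :
    HasDerivWithinAt (fun t : ℝ => potential φ u (pt x t)) (u (gradient φ x)) (Ici 0) 0 := by
  set y₀ := gradient φ x with hy₀
  have hint := gradient_mem_interior_Delta hc hd x
  have hmem := interior_subset hint
  rw [hasDerivWithinAt_iff_isLittleO, Asymptotics.isLittleO_iff]
  intro ε hε
  obtain ⟨r, hr, hball⟩ := Metric.mem_nhds_iff.1
    ((hu.continuousAt (isOpen_interior.mem_nhds hint)).eventually
      (gt_mem_nhds (show u y₀ < u y₀ + ε by linarith)))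
  -- With error slope `r / 2`, an index at distance at least `r` from `y₀` loses at least `δ r / 2`
  -- at time zero, more than the possible gain `2 M s` for small `s`.
  obtain ⟨δ, hδ, H⟩ := exists_le_add_inner_gradient hd x (ε := r / 2) (by positivity)
  have hsmall : ∀ᶠ s : ℝ in 𝓝 0, s * (2 * M) < δ * r / 2 := by
    have : Tendsto (fun s : ℝ => s * (2 * M)) (𝓝 0) (𝓝 (0 * (2 * M))) :=
      tendsto_id.mul_const _
    rw [zero_mul] at this
    exact this.eventually (gt_mem_nhds (by positivity))
  filter_upwards [self_mem_nhdsWithin, nhdsWithin_le_nhds hsmall] with s hs hs2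
  rw [mem_Ici] at hs
  rw [potential_zero hM hc hd, sub_zero, smul_eq_mul, Real.norm_eq_abs, Real.norm_eq_abs,
    abs_of_nonneg hs]
  have hlow : φ x + s * u y₀ ≤ potential φ u (pt x s) := by
    have h1 := le_potential hM hmem (pt x s)
    have h2 := realConj_gradient hc.convexOn hd x
    simp only [pt, WithLp.toLp_fst, WithLp.toLp_snd] at h1
    simp only [pt]
    linarith
  have hup : potential φ u (pt x s) ≤ φ x + s * u y₀ + ε * s := by
    refine potential_le ⟨_, hmem⟩ fun y hy => ?_
    simp only [pt, WithLp.toLp_fst, WithLp.toLp_snd]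
    rcases lt_or_ge ‖y - y₀‖ r with hlt | hge
    · have h1 : u y < u y₀ + ε := hball (mem_ball_iff_norm.2 hlt)
      have h2 := inner_sub_le_realConj hy x
      rw [real_inner_comm] at h2
      nlinarith [mul_le_mul_of_nonneg_left h1.le hs]
    · have hpos : 0 < ‖y - y₀‖ := hr.trans_le hge
      set h := (δ / ‖y - y₀‖) • (y - y₀) with hh
      have hnorm : ‖h‖ = δ := by
        rw [hh, norm_smul, Real.norm_of_nonneg (by positivity)]
        field_simp
      have hinner : inner ℝ h (y - y₀) = δ * ‖y - y₀‖ := by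
        rw [hh, real_inner_smul_left, real_inner_self_eq_norm_sq]
        field_simp
      have h1 := H h hnorm.le
      have h2 := inner_sub_le_realConj hy (x + h)
      rw [inner_add_left, real_inner_comm] at h2
      rw [inner_sub_right, real_inner_comm y₀ h] at hinner
      rw [hnorm, ← hy₀] at h1
      have h3 : δ * r ≤ δ * ‖y - y₀‖ := by gcongr
      have h4 : s * u y - s * u y₀ ≤ s * (2 * M) := by
        rw [← mul_sub]
        refine mul_le_mul_of_nonneg_left ?_ hs
        linarith [(abs_le.1 (hM y hy)).2, (abs_le.1 (hM y₀ hmem)).1]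
      have h5 : 0 ≤ ε * s := by positivity
      linarith
  rw [abs_le]
  constructor <;> nlinarith

/-- A subgradient of the potential at positive time has its space component in `Δ_φ`. -/
theorem fst_mem_Delta_of_mem_subdiff (hM : ∀ y ∈ Delta (asEReal φ), |u y| ≤ M)
    (hne : (Delta (asEReal φ)).Nonempty) {p q : SpTime n} (hp : 0 < p.snd)
    (hq : q ∈ subdiff {p : SpTime n | 0 < p.snd} (potential φ u) p) :
    q.fst ∈ Delta (asEReal φ) := by
  refine mem_Delta_asEReal.2
    ⟨potential φ u p - inner ℝ q.fst p.fst - |p.snd| * M, fun z => ?_⟩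
  -- In the time slice of `p` the potential is at most `φ` plus a constant.
  have h1 := hq (pt z p.snd) (by simpa [pt] using hp)
  have h2 : potential φ u (pt z p.snd) ≤ φ z + |p.snd| * M :=
    potential_le hne fun y hy => affine_le_add hM hy z p.snd
  have h3 : inner ℝ q (pt z p.snd - p) = inner ℝ q.fst z - inner ℝ q.fst p.fst := by
    simp [WithLp.prod_inner_apply, pt, inner_sub_right]
  rw [h3] at h1
  rw [real_inner_comm]
  linarith

/-- If the space component of a subgradient of the potential is interior to `Δ_φ`, then its time
component is the value of `u` there. -/
theorem snd_eq_of_mem_subdiff (hM : ∀ y ∈ Delta (asEReal φ), |u y| ≤ M)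
    (hu : ConcaveOn ℝ (Delta (asEReal φ)) u) {p q : SpTime n} (hp : 0 < p.snd)
    (hq : q ∈ subdiff {p : SpTime n | 0 < p.snd} (potential φ u) p)
    (hint : q.fst ∈ interior (Delta (asEReal φ))) : q.snd = u q.fst := by
  have hmem := interior_subset hint
  have key : ∀ s : ℝ, 0 < s → (q.snd - u q.fst) * (s - p.snd) ≤ 0 := by
    intro s hs
    have hconv : ConvexOn ℝ (Delta (asEReal φ)) fun y => realConj φ y - s * u y :=
      (convexOn_realConj φ).sub (hu.smul hs.le)
    -- At `(z, s)` the supremum is attained at the index `q.fst`.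
    obtain ⟨z, hz⟩ := hconv.exists_subgradient hint
    have h1 : potential φ u (pt z s) ≤ inner ℝ q.fst z - realConj φ q.fst + s * u q.fst := by
      refine potential_le ⟨_, hmem⟩ fun y hy => ?_
      have := hz y hy
      rw [inner_sub_right, real_inner_comm, real_inner_comm q.fst] at this
      simp only [pt, WithLp.toLp_fst, WithLp.toLp_snd]
      linarith
    have h2 := hq (pt z s) (by simpa [pt] using hs)
    have h3 : inner ℝ q (pt z s - p) =
        inner ℝ q.fst z - inner ℝ q.fst p.fst + q.snd * (s - p.snd) := by
      simp [WithLp.prod_inner_apply, pt, inner_sub_right]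
      ring
    rw [h3] at h2
    have h4 := le_potential hM hmem p
    linarith
  -- One time after and one before `p.snd` give opposite signs.
  have h1 := key (2 * p.snd) (by linarith)
  have h2 := key (p.snd / 2) (by linarith)
  have h3 : (q.snd - u q.fst) * p.snd = 0 := by linarith
  rcases mul_eq_zero.1 h3 with h | h
  · linarith
  · exact absurd h hp.ne'

/-- Over a convex set, the frontier and the graph of a function continuous in the interior are
null sets of space-time. -/
theorem volume_frontier_union_graph {s : Set (Sp n)} (hs : Convex ℝ s)
    (hu : ContinuousOn u (interior s)) :
    volume {p : SpTime n | p.fst ∈ frontier s ∨ p.fst ∈ interior s ∧ p.snd = u p.fst} = 0 := by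
  classical
  -- Extension by zero makes the graph that of a globally measurable function, with one-point
  -- vertical slices.
  have hmeas : Measurable ((interior s).piecewise u 0) :=
    hu.measurable_piecewise continuous_zero.continuousOn isOpen_interior.measurableSet
  have hfront : volume (frontier s ×ˢ (univ : Set ℝ)) = 0 := by
    rw [Measure.volume_eq_prod, Measure.prod_prod, hs.addHaar_frontier volume, zero_mul]
  have hgraph : volume {p : Sp n × ℝ | p.2 = (interior s).piecewise u 0 p.1} = 0 := by
    rw [Measure.volume_eq_prod, Measure.measure_prod_null (measurableSet_graph hmeas)]
    exact Eventually.of_forall fun z =>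
      measure_singleton (μ := (volume : Measure ℝ)) ((interior s).piecewise u 0 z)
  refine measure_mono_null ?_
    ((WithLp.volume_preserving_ofLp (Sp n) ℝ).quasiMeasurePreserving.preimage_null
      (measure_union_null hfront hgraph))
  rintro p (hp | ⟨hp, hpu⟩)
  · exact Or.inl ⟨hp, mem_univ _⟩
  · refine Or.inr ?_
    change p.snd = (interior s).piecewise u 0 p.fst
    rw [piecewise_eq_of_mem _ _ _ hp, hpu]

theorem isMongeAmpereMeasure_potential (hM : ∀ y ∈ Delta (asEReal φ), |u y| ≤ M)
    (hne : (Delta (asEReal φ)).Nonempty) (hu : ConcaveOn ℝ (Delta (asEReal φ)) u) :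
    IsMongeAmpereMeasure {p : SpTime n | 0 < p.snd} (potential φ u) 0 := by
  intro B hB _
  rw [Measure.coe_zero, Pi.zero_apply]
  refine (measure_mono_null (iUnion₂_subset fun p hp q hq => ?_)
    (volume_frontier_union_graph (convex_Delta φ) hu.continuousOn_interior)).symm
  have hmem := fst_mem_Delta_of_mem_subdiff hM hne (hB hp) hq
  by_cases hint : q.fst ∈ interior (Delta (asEReal φ))
  · exact Or.inr ⟨hint, snd_eq_of_mem_subdiff hM hu (hB hp) hq hint⟩
  · exact Or.inl ⟨subset_closure hmem, hint⟩

end HRMA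

end CauchyProblem

theorem proposition2 (n : ℕ) (φ u : HRMA.Sp n → ℝ)
    (hφ_diff : Differentiable ℝ φ)
    (hφ_conv : StrictConvexOn ℝ Set.univ φ)
    (hu_smooth : ContDiffOn ℝ ((⊤ : ℕ∞) : WithTop ℕ∞) u (interior (HRMA.Delta (HRMA.asEReal φ))))
    (hu_bdd : ∃ M : ℝ, ∀ y ∈ HRMA.Delta (HRMA.asEReal φ), |u y| ≤ M)
    (hu_conc : StrictConcaveOn ℝ (HRMA.Delta (HRMA.asEReal φ)) u) :
    (∀ t : ℝ, 0 ≤ t → HRMA.tildeCurve φ u t = HRMA.hatCurve φ u t) ∧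
    HRMA.SolvesHRMA φ (fun x => u (gradient φ x)) (HRMA.tildeCurve φ u) := by
  obtain ⟨M, hM⟩ := hu_bdd
  have hgrad := HRMA.gradient_mem_interior_Delta hφ_conv hφ_diff
  have hne : (HRMA.Delta (HRMA.asEReal φ)).Nonempty := ⟨_, interior_subset (hgrad 0)⟩
  refine ⟨fun t ht => HRMA.tildeCurve_eq_hatCurve φ u ht, ?_, ?_, HRMA.potential φ u, ?_, ?_, ?_,
    ?_, ?_⟩
  · exact hu_smooth.continuousOn.comp_continuous
      (hφ_conv.convexOn.continuous_gradient hφ_diff) hgrad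
  · exact ⟨M, fun x => hM _ (interior_subset (hgrad x))⟩
  · exact fun t _ x => HRMA.tildeCurve_eq_potential hM hne t x
  · have hlin : Convex ℝ {p : HRMA.SpTime n | 0 ≤ p.snd} := by
      intro p hp q hq a b ha hb _
      exact add_nonneg (mul_nonneg ha hp) (mul_nonneg hb hq)
    exact (HRMA.convexOn_potential hM hne).subset (subset_univ _) hlin
  · exact HRMA.isMongeAmpereMeasure_potential hM hne hu_conc.concaveOn
  · exact HRMA.potential_zero hM hφ_conv hφ_diff
  · exact HRMA.hasDerivWithinAt_potential hM hu_smooth.continuousOn hφ_conv hφ_diff
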